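/- Let $\mathbb{L}^{n+2}$ be $\mathbb{R}^{n+2}$ with coordinates $(t,x_1,\dots,x_{n+1})$ and the Lorentzian metric $\langle\,,\rangle=-dt^2+dx_1^2+\dots+dx_{n+1}^2$, and let $Q(1)=\{(t,x)\in\mathbb{R}\times\mathbb{R}^{n+1} : x_1^2+\dots+x_{n+1}^2=1\}\subset\mathbb{L}^{n+2}$ with the induced Lorentzian metric; it is the static Einstein spacetime $\mathbb{R}\times\mathbb{S}^n$. Let $M^k$ be a $k$-dimensional smooth manifold and let $\Psi=(\Psi_0,\Psi_1,\dots,\Psi_{n+1})\colon M^k\to Q(1)\subset\mathbb{L}^{n+2}$ be a spacelike immersion, that is, a smooth immersion whose induced metric $g=\Psi^*\langle\,,\rangle$ is Riemannian. Then $\Psi$ is stationary, i.e. its mean curvature vector field as an immersion into $Q(1)$ vanishes identically, if and only if, on $M^k$, $$\Delta\Psi_0=0,\qquad \Delta\Psi_i+\big(k+\|\nabla\Psi_0\|^2\big)\Psi_i=0,\quad i=1,\dots,n+1,$$ where $\Delta$ (the trace of the Hessian), the gradient $\nabla$ and the norm $\|\cdot\|$ are those of $g$. -/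

import Mathlib

open scoped Manifold ContDiff

noncomputable section

namespace SpacelikeImm

/-! ### Lorentz-Minkowski spacetime and the static Einstein spacetime -/

/-- The coordinate space underlying Lorentz-Minkowski spacetime of dimension `n + 2`, with
coordinates `(t, x₁, …, x_{n+1})`; the time coordinate `t` has index `0`. -/
abbrev Minkowski (n : ℕ) : Type := Fin (n + 2) → ℝ

/-- The Lorentzian metric `-(dt)² + (dx₁)² + ⋯ + (dx_{n+1})²`. -/
def lorentz {n : ℕ} (v w : Minkowski n) : ℝ :=
  -(v 0 * w 0) + ∑ i : Fin (n + 1), v i.succ * w i.succ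

/-- The rotation hypersurface `{(t, x) : t ∈ J, ‖x‖² = r(t)²}` of Lorentz-Minkowski spacetime. -/
def rotationHypersurface (n : ℕ) (J : Set ℝ) (r : ℝ → ℝ) : Set (Minkowski n) :=
  {p | p 0 ∈ J ∧ ∑ i : Fin (n + 1), p i.succ ^ 2 = r (p 0) ^ 2}

/-- The static Einstein spacetime `ℝ × 𝕊ⁿ`, as the hypersurface `{(t, x) : ‖x‖² = 1}`. -/
def staticEinstein (n : ℕ) : Set (Minkowski n) :=
  rotationHypersurface n Set.univ (fun _ => 1)

/-- The tangent space of the static Einstein spacetime at `p = (t, x)`: the vectors `(a, v)`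
with `∑ vᵢ xᵢ = 0`. -/
def tangentStaticEinstein {n : ℕ} (p : Minkowski n) : Submodule ℝ (Minkowski n) where
  carrier := {v | ∑ i : Fin (n + 1), v i.succ * p i.succ = 0}
  add_mem' := by
    intro a b ha hb
    simp only [Set.mem_ofPred_eq, Pi.add_apply, add_mul, Finset.sum_add_distrib] at *
    rw [ha, hb, add_zero]
  zero_mem' := by simp
  smul_mem' := by
    intro c a ha
    simp only [Set.mem_ofPred_eq, Pi.smul_apply, smul_eq_mul, mul_assoc,
      ← Finset.mul_sum] at *
    rw [ha, mul_zero]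

/-- The spacelike unit normal `N(t, x) = (0, x)` of the static Einstein spacetime. -/
def unitNormal {n : ℕ} (p : Minkowski n) : Minkowski n :=
  Fin.cons 0 (fun i : Fin (n + 1) => p i.succ)

/-- The Lorentz-orthogonal projection onto the tangent space of the static Einstein spacetime
at `p`. -/
def tangentProj {n : ℕ} (p w : Minkowski n) : Minkowski n :=
  w - lorentz w (unitNormal p) • unitNormal p

theorem tangentProj_mem {n : ℕ} {p : Minkowski n} (hp : p ∈ staticEinstein n)
    (w : Minkowski n) : tangentProj p w ∈ tangentStaticEinstein p := by
  have h : ∑ i : Fin (n + 1), p i.succ * p i.succ = 1 := by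
    have := hp.2
    simpa [sq] using this
  change ∑ i : Fin (n + 1), tangentProj p w i.succ * p i.succ = 0
  simp only [tangentProj, unitNormal, lorentz, Pi.sub_apply, Pi.smul_apply, smul_eq_mul,
    Fin.cons_succ, Fin.cons_zero, mul_zero, neg_zero, zero_add, sub_mul, mul_assoc,
    Finset.sum_sub_distrib, ← Finset.mul_sum, h]
  simp

theorem lorentz_sub_tangentProj {n : ℕ} {p v : Minkowski n} (hv : v ∈ tangentStaticEinstein p)
    (w : Minkowski n) : lorentz (w - tangentProj p w) v = 0 := by
  have h : ∑ i : Fin (n + 1), v i.succ * p i.succ = 0 := hv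
  have h' : ∑ i : Fin (n + 1), p i.succ * v i.succ = 0 := by
    simpa only [mul_comm] using h
  simp only [tangentProj, sub_sub_cancel]
  generalize lorentz w (unitNormal p) = c
  simp [lorentz, unitNormal, mul_assoc, ← Finset.mul_sum, h']

/-! ### Coordinates on a `k`-dimensional manifold -/

/-- The partial derivative `∂ᵢ F` of a map on `ℝᵏ`. -/
def partialDeriv {k : ℕ} {V : Type*} [NormedAddCommGroup V] [NormedSpace ℝ V]
    (i : Fin k) (F : EuclideanSpace ℝ (Fin k) → V) (y : EuclideanSpace ℝ (Fin k)) : V :=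
  fderiv ℝ F y (EuclideanSpace.single i 1)

section Manifold

variable {k : ℕ} {M : Type*} [TopologicalSpace M] [ChartedSpace (EuclideanSpace ℝ (Fin k)) M]

/-- The expression of a map on `M` in the coordinates of the preferred chart around `x`. -/
def inCoord {V : Type*} (x : M) (f : M → V) : EuclideanSpace ℝ (Fin k) → V :=
  fun y => f ((extChartAt (𝓡 k) x).symm y)

/-- The coordinate vector field `∂ᵢ` of the preferred chart around `x`, at the point with
coordinates `y`. -/
def coordField (x : M) (i : Fin k) (y : EuclideanSpace ℝ (Fin k)) :
    TangentSpace (𝓡 k) ((extChartAt (𝓡 k) x).symm y) :=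
  mfderiv 𝓘(ℝ, EuclideanSpace ℝ (Fin k)) (𝓡 k) (extChartAt (𝓡 k) x).symm y
    (EuclideanSpace.single i 1 : EuclideanSpace ℝ (Fin k))

/-! ### Riemannian metrics: Christoffel symbols, Laplacian, gradient

A metric is a family `g` of functions of two tangent vectors.  All quantities at `x` are computed
in the preferred chart around `x`; they do not depend on the chart. -/

/-- The matrix `(g_{ij})` of the metric in the chart around `x`, at the coordinates `y`. -/
def metricMatrix (g : ∀ z : M, TangentSpace (𝓡 k) z → TangentSpace (𝓡 k) z → ℝ) (x : M)
    (y : EuclideanSpace ℝ (Fin k)) : Matrix (Fin k) (Fin k) ℝ :=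
  Matrix.of fun i j => g ((extChartAt (𝓡 k) x).symm y) (coordField x i y) (coordField x j y)

/-- The entries `g^{ij}` of the inverse matrix, at the point `x`. -/
def metricInv (g : ∀ z : M, TangentSpace (𝓡 k) z → TangentSpace (𝓡 k) z → ℝ) (x : M) :
    Matrix (Fin k) (Fin k) ℝ :=
  (metricMatrix g x (extChartAt (𝓡 k) x x))⁻¹

/-- The Christoffel symbol `Γˡᵢⱼ` of the Levi-Civita connection of `g`, at the point `x`. -/
def christoffel (g : ∀ z : M, TangentSpace (𝓡 k) z → TangentSpace (𝓡 k) z → ℝ) (x : M)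
    (l i j : Fin k) : ℝ :=
  (1 / 2 : ℝ) * ∑ m : Fin k, metricInv g x l m *
    (partialDeriv i (fun y => metricMatrix g x y j m) (extChartAt (𝓡 k) x x)
      + partialDeriv j (fun y => metricMatrix g x y i m) (extChartAt (𝓡 k) x x)
      - partialDeriv m (fun y => metricMatrix g x y i j) (extChartAt (𝓡 k) x x))

/-- The Hessian `(∇df)(∂ᵢ, ∂ⱼ)` at `x`, for the Levi-Civita connection of `g`. -/
def hessian (g : ∀ z : M, TangentSpace (𝓡 k) z → TangentSpace (𝓡 k) z → ℝ) (f : M → ℝ) (x : M)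
    (i j : Fin k) : ℝ :=
  partialDeriv i (partialDeriv j (inCoord x f)) (extChartAt (𝓡 k) x x)
    - ∑ l : Fin k, christoffel g x l i j * partialDeriv l (inCoord x f) (extChartAt (𝓡 k) x x)

/-- The Laplacian `Δf` of the metric `g`: the trace of the Hessian (so that
`Δ = ∑ ∂ᵢ²` in Euclidean space). -/
def laplacian (g : ∀ z : M, TangentSpace (𝓡 k) z → TangentSpace (𝓡 k) z → ℝ) (f : M → ℝ)
    (x : M) : ℝ :=
  ∑ i : Fin k, ∑ j : Fin k, metricInv g x i j * hessian g f x i j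

/-- The squared norm `‖∇f‖²` of the gradient of `f` for the metric `g`. -/
def gradNormSq (g : ∀ z : M, TangentSpace (𝓡 k) z → TangentSpace (𝓡 k) z → ℝ) (f : M → ℝ)
    (x : M) : ℝ :=
  ∑ i : Fin k, ∑ j : Fin k, metricInv g x i j *
    (partialDeriv i (inCoord x f) (extChartAt (𝓡 k) x x)
      * partialDeriv j (inCoord x f) (extChartAt (𝓡 k) x x))

/-! ### Spacelike immersions -/

variable {n : ℕ}

/-- The metric induced on `M` by a map into Lorentz-Minkowski spacetime. -/
def inducedMetric (Ψ : M → Minkowski n) (z : M) (v w : TangentSpace (𝓡 k) z) : ℝ :=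
  lorentz (n := n) (mfderiv (𝓡 k) 𝓘(ℝ, Minkowski n) Ψ z v)
    (mfderiv (𝓡 k) 𝓘(ℝ, Minkowski n) Ψ z w)

/-- `Ψ` is a spacelike immersion into the static Einstein spacetime: it is smooth, takes values
there, and induces a positive definite metric (in particular each differential is injective).
The static Einstein spacetime is an embedded submanifold, so smoothness may be tested in the
ambient space. -/
structure IsSpacelikeImmersion (k : ℕ) {M : Type*} [TopologicalSpace M]
    [ChartedSpace (EuclideanSpace ℝ (Fin k)) M] {n : ℕ} (Ψ : M → Minkowski n) : Prop where
  smooth : ContMDiff (𝓡 k) 𝓘(ℝ, Minkowski n) ∞ Ψ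
  maps_to : ∀ z, Ψ z ∈ staticEinstein n
  spacelike : ∀ (z : M) (v : TangentSpace (𝓡 k) z), v ≠ 0 → 0 < inducedMetric Ψ z v v

/-- The image `dΨ(∂ᵢ) = ∂ᵢΨ` at `x`. -/
def tangentFrame (Ψ : M → Minkowski n) (x : M) (i : Fin k) : Minkowski n :=
  partialDeriv i (inCoord x Ψ) (extChartAt (𝓡 k) x x)

/-- The covariant derivative of `∂ⱼΨ` in the direction `∂ᵢ` at `x`, for the Levi-Civita
connection of the static Einstein spacetime: the tangential part of the derivative for the flat
connection of Lorentz-Minkowski spacetime. -/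
def covDerivFrame (Ψ : M → Minkowski n) (x : M) (i j : Fin k) : Minkowski n :=
  tangentProj (Ψ x) (partialDeriv i (partialDeriv j (inCoord x Ψ)) (extChartAt (𝓡 k) x x))

/-- The component of `w` that is Lorentz-orthogonal to the image of the differential of `Ψ`
at `x`: subtract the orthogonal projection onto the span of the `∂ₐΨ`. -/
def normalPart (k : ℕ) {M : Type*} [TopologicalSpace M]
    [ChartedSpace (EuclideanSpace ℝ (Fin k)) M] {n : ℕ} (Ψ : M → Minkowski n) (x : M)
    (w : Minkowski n) : Minkowski n :=
  w - ∑ a : Fin k, ∑ b : Fin k,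
    (metricInv (inducedMetric Ψ) x a b * lorentz w (tangentFrame Ψ x a)) • tangentFrame Ψ x b

/-- The second fundamental form, on `(∂ᵢ, ∂ⱼ)`, of `Ψ` as an immersion into the static Einstein
spacetime. -/
def secondFundamentalForm (Ψ : M → Minkowski n) (x : M) (i j : Fin k) : Minkowski n :=
  normalPart k Ψ x (covDerivFrame Ψ x i j)

/-- The mean curvature vector at `x` of `Ψ` as an immersion into the static Einstein spacetime:
`1 / k` times the trace of the second fundamental form. -/
def meanCurvature (k : ℕ) {M : Type*} [TopologicalSpace M]
    [ChartedSpace (EuclideanSpace ℝ (Fin k)) M] {n : ℕ} (Ψ : M → Minkowski n) (x : M) :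
    Minkowski n :=
  (1 / (k : ℝ)) • ∑ i : Fin k, ∑ j : Fin k,
    metricInv (inducedMetric Ψ) x i j • secondFundamentalForm Ψ x i j

/-- `Ψ` is stationary in the static Einstein spacetime: its mean curvature vector field vanishes
identically. -/
def IsStationary (k : ℕ) {M : Type*} [TopologicalSpace M]
    [ChartedSpace (EuclideanSpace ℝ (Fin k)) M] {n : ℕ} (Ψ : M → Minkowski n) : Prop :=
  ∀ x : M, meanCurvature k Ψ x = 0

end Manifold

end SpacelikeImm

end

noncomputable section

namespace SpacelikeImm

/-! ### The Lorentzian product as a continuous bilinear map -/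

/-! The equations are the coordinates of one vector identity, tr II = ΔΨ + (k + ‖∇Ψ₀‖²) N(Ψ), where
N(t, x) = (0, x) is the unit normal of the static Einstein spacetime. By the Gauss formula for the
flat ambient space, the Hessian of a coordinate of Ψ is that coordinate of the part of ∂ᵢ∂ⱼΨ normal
to M (`christoffel_eq`, `hessian_apply`). Passing to the second fundamental form in the hypersurface
only removes the component along N, as N is itself normal to M (`normalPart_tangentProj`). That
component comes from differentiating ⟨Ψ, N(Ψ)⟩ = 1 twice: ⟨∂ᵢ∂ⱼΨ, N⟩ = -(gᵢⱼ + ∂ᵢΨ₀ ∂ⱼΨ₀), with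
trace -(k + ‖∇Ψ₀‖²). -/

theorem lorentz_comm {n : ℕ} (v w : Minkowski n) : lorentz v w = lorentz w v := by
  simp only [lorentz, mul_comm]

theorem lorentz_add_left {n : ℕ} (u v w : Minkowski n) :
    lorentz (u + v) w = lorentz u w + lorentz v w := by
  simp only [lorentz, Pi.add_apply, add_mul, Finset.sum_add_distrib]
  ring

theorem lorentz_smul_left {n : ℕ} (c : ℝ) (v w : Minkowski n) :
    lorentz (c • v) w = c * lorentz v w := by
  simp only [lorentz, Pi.smul_apply, smul_eq_mul, mul_add, Finset.mul_sum, mul_assoc, mul_neg]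

/-- The Lorentzian product as a continuous bilinear map. -/
def lorentzCLM (n : ℕ) : Minkowski n →L[ℝ] Minkowski n →L[ℝ] ℝ :=
  (LinearMap.mk₂ ℝ lorentz lorentz_add_left lorentz_smul_left
    (fun u v w => by rw [lorentz_comm, lorentz_add_left, lorentz_comm v, lorentz_comm w])
    (fun c v w => by
      rw [lorentz_comm, lorentz_smul_left, lorentz_comm w, smul_eq_mul])).toContinuousBilinearMap

theorem lorentzCLM_apply {n : ℕ} (v w : Minkowski n) : lorentzCLM n v w = lorentz v w := rfl

/-- Pairing with N drops the time term. This correction is the origin of ‖∇Ψ₀‖² in the final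
equations. -/
theorem lorentz_unitNormal {n : ℕ} (p q : Minkowski n) :
    lorentz p (unitNormal q) = lorentz p q + p 0 * q 0 := by
  simp [lorentz, unitNormal]

theorem lorentz_unitNormal_comm {n : ℕ} (p q : Minkowski n) :
    lorentz p (unitNormal q) = lorentz q (unitNormal p) := by
  rw [lorentz_unitNormal, lorentz_unitNormal, lorentz_comm, mul_comm (p 0)]

/-- The symmetric bilinear form `⟨v, N(w)⟩ = ∑ vᵢ wᵢ`, the sum being over the spatial
coordinates. -/
def spatialCLM (n : ℕ) : Minkowski n →L[ℝ] Minkowski n →L[ℝ] ℝ :=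
  (LinearMap.mk₂ ℝ (fun v w : Minkowski n => lorentz v (unitNormal w))
    (fun _ _ _ => lorentz_add_left _ _ _) (fun _ _ _ => lorentz_smul_left _ _ _)
    (fun u v w => by
      rw [lorentz_unitNormal_comm, lorentz_add_left, lorentz_unitNormal_comm v,
        lorentz_unitNormal_comm w])
    (fun c v w => by
      rw [lorentz_unitNormal_comm, lorentz_smul_left, lorentz_unitNormal_comm w,
        smul_eq_mul])).toContinuousBilinearMap

theorem spatialCLM_apply {n : ℕ} (v w : Minkowski n) :
    spatialCLM n v w = lorentz v (unitNormal w) := rfl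

theorem lorentz_unitNormal_self {n : ℕ} {p : Minkowski n} (hp : p ∈ staticEinstein n) :
    lorentz p (unitNormal p) = 1 := by
  have h := hp.2
  simpa [lorentz, unitNormal, sq] using h

/-! ### Rules for partial derivatives -/

section Calculus

variable {k : ℕ} {V W : Type*} [NormedAddCommGroup V] [NormedSpace ℝ V]
  [NormedAddCommGroup W] [NormedSpace ℝ W] {F A B : EuclideanSpace ℝ (Fin k) → V}
  {y : EuclideanSpace ℝ (Fin k)}

theorem partialDeriv_congr (h : A =ᶠ[nhds y] B) (i : Fin k) :
    partialDeriv i A y = partialDeriv i B y := by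
  rw [partialDeriv, partialDeriv, h.fderiv_eq]

theorem partialDeriv_clm_comp (L : V →L[ℝ] W) (hF : DifferentiableAt ℝ F y) (i : Fin k) :
    partialDeriv i (fun z => L (F z)) y = L (partialDeriv i F y) := by
  have h : HasFDerivAt (fun z => L (F z)) (L.comp (fderiv ℝ F y)) y :=
    L.hasFDerivAt.comp y hF.hasFDerivAt
  rw [partialDeriv, h.fderiv]
  rfl

theorem partialDeriv_bilinear (L : V →L[ℝ] V →L[ℝ] W) (hA : DifferentiableAt ℝ A y)
    (hB : DifferentiableAt ℝ B y) (i : Fin k) :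
    partialDeriv i (fun z => L (A z) (B z)) y =
      L (partialDeriv i A y) (B y) + L (A y) (partialDeriv i B y) := by
  rw [partialDeriv, (L.hasFDerivAt_of_bilinear hA.hasFDerivAt hB.hasFDerivAt).fderiv, add_comm]
  rfl

theorem differentiableAt_partialDeriv (hF : ContDiffAt ℝ 2 F y) (i : Fin k) :
    DifferentiableAt ℝ (partialDeriv i F) y := by
  have h : ContDiffAt ℝ 1 (fderiv ℝ F) y := hF.fderiv_right (by norm_num)
  exact (h.differentiableAt one_ne_zero).clm_apply (differentiableAt_const _)

theorem eventually_differentiableAt (hF : ContDiffAt ℝ 2 F y) :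
    ∀ᶠ z in nhds y, DifferentiableAt ℝ F z :=
  (hF.eventually (by simp)).mono fun _ h => h.differentiableAt two_ne_zero

theorem partialDeriv_partialDeriv_clm_comp (L : V →L[ℝ] W) (hF : ContDiffAt ℝ 2 F y)
    (i j : Fin k) :
    partialDeriv i (partialDeriv j (fun z => L (F z))) y =
      L (partialDeriv i (partialDeriv j F) y) := by
  rw [← partialDeriv_clm_comp L (differentiableAt_partialDeriv hF j)]
  -- The outer derivative needs the first-order identity on a neighbourhood of `y`, not only at `y`.
  exact partialDeriv_congr
    ((eventually_differentiableAt hF).mono fun z hz => partialDeriv_clm_comp L hz j) i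

theorem partialDeriv_comm (hF : ContDiffAt ℝ 2 F y) (i j : Fin k) :
    partialDeriv i (partialDeriv j F) y = partialDeriv j (partialDeriv i F) y := by
  have h : DifferentiableAt ℝ (fderiv ℝ F) y :=
    ContDiffAt.differentiableAt (n := 1) (hF.fderiv_right (by norm_num)) one_ne_zero
  have key : ∀ a b : Fin k, partialDeriv a (partialDeriv b F) y =
      fderiv ℝ (fderiv ℝ F) y (EuclideanSpace.single a 1) (EuclideanSpace.single b 1) := by
    intro a b
    exact partialDeriv_clm_comp (ContinuousLinearMap.apply ℝ V (EuclideanSpace.single b 1)) h a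
  rw [key, key]
  exact (hF.isSymmSndFDerivAt (by simp)).eq _ _

end Calculus

/-! ### The induced metric and the Gauss formula in a chart. -/

section Manifold

variable {k : ℕ} {M : Type*} [TopologicalSpace M] [ChartedSpace (EuclideanSpace ℝ (Fin k)) M]
  {n : ℕ} {Ψ : M → Minkowski n}

theorem metricMatrix_comm (x : M) (y : EuclideanSpace ℝ (Fin k)) (i j : Fin k) :
    metricMatrix (inducedMetric Ψ) x y i j = metricMatrix (inducedMetric Ψ) x y j i :=
  lorentz_comm _ _

theorem metricInv_comm (x : M) (i j : Fin k) :
    metricInv (k := k) (inducedMetric Ψ) x i j = metricInv (inducedMetric Ψ) x j i := by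
  have h : (metricMatrix (inducedMetric Ψ) x (extChartAt (𝓡 k) x x)).transpose =
      metricMatrix (inducedMetric Ψ) x (extChartAt (𝓡 k) x x) :=
    Matrix.ext fun a b => metricMatrix_comm x _ b a
  have h' := Matrix.transpose_nonsing_inv (metricMatrix (inducedMetric Ψ) x (extChartAt (𝓡 k) x x))
  rw [h] at h'
  exact congrFun (congrFun h' j) i

variable [IsManifold (𝓡 k) ∞ M]

theorem IsSpacelikeImmersion.contDiffAt_inCoord (hΨ : IsSpacelikeImmersion k Ψ) (x : M)
    {y : EuclideanSpace ℝ (Fin k)} (hy : y ∈ (extChartAt (𝓡 k) x).target) :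
    ContDiffAt ℝ 2 (inCoord x Ψ) y := by
  have h : ContMDiffOn 𝓘(ℝ, EuclideanSpace ℝ (Fin k)) 𝓘(ℝ, Minkowski n) ∞ (inCoord x Ψ)
      (extChartAt (𝓡 k) x).target :=
    hΨ.smooth.comp_contMDiffOn (contMDiffOn_extChartAt_symm x)
  exact contDiffAt_infty.1 ((contMDiffOn_iff_contDiffOn.1 h).contDiffAt
    ((isOpen_extChartAt_target x).mem_nhds hy)) 2

/-- Chain rule, on the whole chart target rather than at the centre alone, because the Christoffel
symbols differentiate the metric matrix. -/
theorem IsSpacelikeImmersion.mfderiv_coordField (hΨ : IsSpacelikeImmersion k Ψ) (x : M)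
    {y : EuclideanSpace ℝ (Fin k)} (hy : y ∈ (extChartAt (𝓡 k) x).target) (i : Fin k) :
    mfderiv (𝓡 k) 𝓘(ℝ, Minkowski n) Ψ ((extChartAt (𝓡 k) x).symm y) (coordField x i y) =
      partialDeriv i (inCoord x Ψ) y := by
  have hs : MDifferentiableAt 𝓘(ℝ, EuclideanSpace ℝ (Fin k)) (𝓡 k) (extChartAt (𝓡 k) x).symm y :=
    ((contMDiffOn_extChartAt_symm (n := ∞) x).contMDiffAt
      ((isOpen_extChartAt_target x).mem_nhds hy)).mdifferentiableAt (by simp)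
  have hm : MDifferentiableAt (𝓡 k) 𝓘(ℝ, Minkowski n) Ψ ((extChartAt (𝓡 k) x).symm y) :=
    hΨ.smooth.mdifferentiable (by simp) _
  have h := mfderiv_comp y hm hs
  rw [mfderiv_eq_fderiv] at h
  exact (congrArg (fun L : EuclideanSpace ℝ (Fin k) →L[ℝ] Minkowski n =>
    L (EuclideanSpace.single i 1)) h).symm

theorem IsSpacelikeImmersion.metricMatrix_apply (hΨ : IsSpacelikeImmersion k Ψ) (x : M)
    {y : EuclideanSpace ℝ (Fin k)} (hy : y ∈ (extChartAt (𝓡 k) x).target) (i j : Fin k) :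
    metricMatrix (inducedMetric Ψ) x y i j =
      lorentz (partialDeriv i (inCoord x Ψ) y) (partialDeriv j (inCoord x Ψ) y) := by
  rw [← hΨ.mfderiv_coordField x hy, ← hΨ.mfderiv_coordField x hy]
  rfl

/-- The matrix of the induced metric is invertible, since the metric is definite. -/
theorem IsSpacelikeImmersion.isUnit_det_metricMatrix (hΨ : IsSpacelikeImmersion k Ψ) (x : M) :
    IsUnit (metricMatrix (inducedMetric Ψ) x (extChartAt (𝓡 k) x x)).det := by
  rw [isUnit_iff_ne_zero]
  intro h0
  -- A kernel vector `c` gives a nonzero tangent vector ∑ cᵢ∂ᵢ whose squared length is cᵀ g c = 0,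
  -- against positivity.
  obtain ⟨c, hc, hz⟩ := Matrix.exists_mulVec_eq_zero_iff.2 h0
  set y := extChartAt (𝓡 k) x x with hy
  have hyt : y ∈ (extChartAt (𝓡 k) x).target := mem_extChartAt_target x
  set S : EuclideanSpace ℝ (Fin k) →L[ℝ] TangentSpace (𝓡 k) ((extChartAt (𝓡 k) x).symm y) :=
    mfderiv 𝓘(ℝ, EuclideanSpace ℝ (Fin k)) (𝓡 k) (extChartAt (𝓡 k) x).symm y with hS
  have hinj : Function.Injective S := by
    have h := isInvertible_mfderivWithin_extChartAt_symm (I := 𝓡 k) hyt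
    rw [modelWithCornersSelf_coe, Set.range_id, mfderivWithin_univ] at h
    exact h.injective
  set D : TangentSpace (𝓡 k) ((extChartAt (𝓡 k) x).symm y) →L[ℝ] Minkowski n :=
    mfderiv (𝓡 k) 𝓘(ℝ, Minkowski n) Ψ ((extChartAt (𝓡 k) x).symm y) with hD
  set e : Fin k → EuclideanSpace ℝ (Fin k) := fun i => EuclideanSpace.single i 1 with he
  have hw : ∑ i, c i • e i ≠ 0 := by
    intro h
    apply hc
    funext i
    have := congrArg (fun v : EuclideanSpace ℝ (Fin k) => v i) h
    simpa [he, Finset.sum_apply, Pi.single_apply] using this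
  have hpos := hΨ.spacelike _ (S (∑ i, c i • e i))
    (fun h => hw (hinj (h.trans (map_zero S).symm)))
  have hval : inducedMetric Ψ _ (S (∑ i, c i • e i)) (S (∑ i, c i • e i)) =
      c ⬝ᵥ (metricMatrix (inducedMetric Ψ) x y).mulVec c := by
    change lorentzCLM n (D (S (∑ i, c i • e i))) (D (S (∑ i, c i • e i))) =
      ∑ i, c i * ∑ j, lorentzCLM n (D (S (e i))) (D (S (e j))) * c j
    simp only [map_sum, map_smul, sum_apply, smul_apply,
      smul_eq_mul, Finset.mul_sum]
    rw [Finset.sum_comm]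
    exact Finset.sum_congr rfl fun i _ => Finset.sum_congr rfl fun j _ => by ring
  rw [hval, hz, dotProduct_zero] at hpos
  exact lt_irrefl _ hpos

/-- The sum is the trace of g⁻¹g by symmetry of g; it supplies the constant k in the equations. -/
theorem IsSpacelikeImmersion.sum_metricInv_mul_metricMatrix (hΨ : IsSpacelikeImmersion k Ψ)
    (x : M) :
    ∑ i : Fin k, ∑ j : Fin k, metricInv (k := k) (inducedMetric Ψ) x i j *
      metricMatrix (inducedMetric Ψ) x (extChartAt (𝓡 k) x x) i j = k := by
  have h := congrArg Matrix.trace (Matrix.nonsing_inv_mul _ (hΨ.isUnit_det_metricMatrix x))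
  rw [Matrix.trace_one, Fintype.card_fin] at h
  rw [← h]
  refine Finset.sum_congr rfl fun i _ => Finset.sum_congr rfl fun j _ => ?_
  rw [metricMatrix_comm]
  rfl

/-- The Christoffel symbols of the induced metric are the tangential coefficients of the second
derivatives of the immersion. -/
theorem IsSpacelikeImmersion.christoffel_eq (hΨ : IsSpacelikeImmersion k Ψ) (x : M)
    (l i j : Fin k) :
    christoffel (inducedMetric Ψ) x l i j = ∑ m : Fin k, metricInv (inducedMetric Ψ) x l m *
      lorentz (partialDeriv i (partialDeriv j (inCoord x Ψ)) (extChartAt (𝓡 k) x x))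
        (tangentFrame Ψ x m) := by
  have hyt := mem_extChartAt_target (I := 𝓡 k) x
  have hF := hΨ.contDiffAt_inCoord x hyt
  -- Product rule for g_bc = ⟨∂_bΨ, ∂_cΨ⟩, valid near the base point.
  have key : ∀ a b c : Fin k,
      partialDeriv a (fun y => metricMatrix (inducedMetric Ψ) x y b c) (extChartAt (𝓡 k) x x) =
        lorentz (partialDeriv a (partialDeriv b (inCoord x Ψ)) (extChartAt (𝓡 k) x x))
          (tangentFrame Ψ x c) +
        lorentz (partialDeriv a (partialDeriv c (inCoord x Ψ)) (extChartAt (𝓡 k) x x))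
          (tangentFrame Ψ x b) := by
    intro a b c
    have h : (fun y => metricMatrix (inducedMetric Ψ) x y b c)
        =ᶠ[nhds (extChartAt (𝓡 k) x x)] fun y => lorentzCLM n (partialDeriv b (inCoord x Ψ) y)
          (partialDeriv c (inCoord x Ψ) y) := by
      filter_upwards [(isOpen_extChartAt_target x).mem_nhds hyt] with y hy
      exact hΨ.metricMatrix_apply x hy b c
    rw [partialDeriv_congr h, partialDeriv_bilinear _ (differentiableAt_partialDeriv hF b)
      (differentiableAt_partialDeriv hF c), lorentzCLM_apply, lorentzCLM_apply,
      lorentz_comm (partialDeriv b _ _)]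
    rfl
  rw [christoffel, Finset.mul_sum]
  refine Finset.sum_congr rfl fun m _ => ?_
  -- Once mixed derivatives are identified, four of the six terms cancel in pairs; the other two are
  -- equal and absorb the factor 1/2.
  rw [key, key, key, partialDeriv_comm hF j i, partialDeriv_comm hF m i, partialDeriv_comm hF m j]
  ring

/-- The Hessian of a coordinate function of the immersion is the corresponding coordinate of the
normal part of the second derivative. -/
theorem IsSpacelikeImmersion.hessian_apply (hΨ : IsSpacelikeImmersion k Ψ) (x : M)
    (c : Fin (n + 2)) (i j : Fin k) :
    hessian (k := k) (inducedMetric Ψ) (fun z => Ψ z c) x i j =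
      normalPart k Ψ x
        (partialDeriv i (partialDeriv j (inCoord x Ψ)) (extChartAt (𝓡 k) x x)) c := by
  have hF := hΨ.contDiffAt_inCoord x (mem_extChartAt_target (I := 𝓡 k) x)
  have h1 : ∀ l, partialDeriv l (inCoord x fun z => Ψ z c) (extChartAt (𝓡 k) x x) =
      tangentFrame Ψ x l c := fun l =>
    partialDeriv_clm_comp (ContinuousLinearMap.proj (R := ℝ) (φ := fun _ : Fin (n + 2) => ℝ) c)
      (hF.differentiableAt two_ne_zero) l
  have h2 : partialDeriv i (partialDeriv j (inCoord x fun z => Ψ z c)) (extChartAt (𝓡 k) x x) =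
      partialDeriv i (partialDeriv j (inCoord x Ψ)) (extChartAt (𝓡 k) x x) c :=
    partialDeriv_partialDeriv_clm_comp
      (ContinuousLinearMap.proj (R := ℝ) (φ := fun _ : Fin (n + 2) => ℝ) c) hF i j
  rw [hessian, h2, normalPart, Pi.sub_apply]
  simp only [h1, hΨ.christoffel_eq, Finset.sum_apply, Pi.smul_apply, smul_eq_mul, Finset.sum_mul]
  rw [Finset.sum_comm]
  congr 1
  refine Finset.sum_congr rfl fun a _ => Finset.sum_congr rfl fun b _ => ?_
  rw [metricInv_comm]

/-! ### The direction normal to the static Einstein spacetime. -/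

/-- First derivative of ⟨Ψ, N(Ψ)⟩ = 1. It is kept on a neighbourhood so that it can be
differentiated again. -/
theorem IsSpacelikeImmersion.eventually_lorentz_partialDeriv_unitNormal
    (hΨ : IsSpacelikeImmersion k Ψ) (x : M) (j : Fin k) :
    ∀ᶠ y in nhds (extChartAt (𝓡 k) x x),
      lorentz (partialDeriv j (inCoord x Ψ) y) (unitNormal (inCoord (k := k) x Ψ y)) = 0 := by
  filter_upwards [eventually_differentiableAt
    (hΨ.contDiffAt_inCoord x (mem_extChartAt_target (I := 𝓡 k) x))] with y hy
  have h := partialDeriv_bilinear (spatialCLM n) hy hy j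
  -- No restriction to the chart target is needed: the inverse chart is a total function into M, and
  -- all of M maps into the hypersurface.
  have hconst : (fun z => spatialCLM n (inCoord x Ψ z) (inCoord x Ψ z)) =
      fun _ : EuclideanSpace ℝ (Fin k) => (1 : ℝ) :=
    funext fun z => lorentz_unitNormal_self (hΨ.maps_to _)
  have h0 : partialDeriv j (fun _ : EuclideanSpace ℝ (Fin k) => (1 : ℝ)) y = 0 := by
    simp [partialDeriv]
  rw [hconst, h0, spatialCLM_apply, spatialCLM_apply, lorentz_unitNormal_comm (inCoord x Ψ y)] at h
  linarith

theorem IsSpacelikeImmersion.lorentz_unitNormal_tangentFrame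
    (hΨ : IsSpacelikeImmersion k Ψ) (x : M) (j : Fin k) :
    lorentz (unitNormal (Ψ x)) (tangentFrame Ψ x j) = 0 := by
  have h := (hΨ.eventually_lorentz_partialDeriv_unitNormal x j).self_of_nhds
  rw [lorentz_comm] at h
  have hx : inCoord (k := k) x Ψ (extChartAt (𝓡 k) x x) = Ψ x := by rw [inCoord, extChartAt_to_inv]
  rwa [hx] at h

/-- The component of the second derivative of the immersion along the unit normal of the static
Einstein spacetime. -/
theorem IsSpacelikeImmersion.lorentz_partialDeriv_partialDeriv_unitNormal
    (hΨ : IsSpacelikeImmersion k Ψ) (x : M) (i j : Fin k) :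
    lorentz (partialDeriv i (partialDeriv j (inCoord x Ψ)) (extChartAt (𝓡 k) x x))
        (unitNormal (Ψ x)) =
      -(metricMatrix (inducedMetric Ψ) x (extChartAt (𝓡 k) x x) i j +
        tangentFrame Ψ x i 0 * tangentFrame Ψ x j 0) := by
  have hyt := mem_extChartAt_target (I := 𝓡 k) x
  have hF := hΨ.contDiffAt_inCoord x hyt
  have h := partialDeriv_bilinear (spatialCLM n) (differentiableAt_partialDeriv hF j)
    (hF.differentiableAt two_ne_zero) i
  have hz : (fun y => spatialCLM n (partialDeriv j (inCoord x Ψ) y) (inCoord x Ψ y))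
      =ᶠ[nhds (extChartAt (𝓡 k) x x)] fun _ => (0 : ℝ) :=
    hΨ.eventually_lorentz_partialDeriv_unitNormal x j
  have h0 : partialDeriv i (fun _ : EuclideanSpace ℝ (Fin k) => (0 : ℝ))
      (extChartAt (𝓡 k) x x) = 0 := by
    simp [partialDeriv]
  -- The remaining term is the spatial product of ∂ᵢΨ and ∂ⱼΨ, that is, gᵢⱼ plus the product of
  -- their time components.
  rw [partialDeriv_congr hz, h0, spatialCLM_apply, spatialCLM_apply, lorentz_unitNormal_comm (partialDeriv j _ _),
    lorentz_unitNormal (partialDeriv i (inCoord x Ψ) _), ← hΨ.metricMatrix_apply x hyt] at h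
  have hx : inCoord (k := k) x Ψ (extChartAt (𝓡 k) x x) = Ψ x := by rw [inCoord, extChartAt_to_inv]
  rw [hx] at h
  simp only [tangentFrame]
  linarith

/-! ### The second fundamental form and its trace. -/

/-- N(Ψ) is orthogonal to every ∂ₐΨ, so removing a multiple of it leaves the tangential coefficients
unchanged. -/
theorem IsSpacelikeImmersion.normalPart_tangentProj (hΨ : IsSpacelikeImmersion k Ψ) (x : M)
    (w : Minkowski n) :
    normalPart k Ψ x (tangentProj (Ψ x) w) =
      normalPart k Ψ x w - lorentz w (unitNormal (Ψ x)) • unitNormal (Ψ x) := by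
  have h : ∀ a : Fin k, lorentz (tangentProj (Ψ x) w) (tangentFrame Ψ x a) =
      lorentz w (tangentFrame Ψ x a) := by
    intro a
    rw [tangentProj, sub_eq_add_neg, ← neg_smul, lorentz_add_left, lorentz_smul_left,
      hΨ.lorentz_unitNormal_tangentFrame, mul_zero, add_zero]
  simp only [normalPart, h]
  rw [tangentProj, sub_right_comm]

theorem IsSpacelikeImmersion.secondFundamentalForm_apply (hΨ : IsSpacelikeImmersion k Ψ) (x : M)
    (i j : Fin k) (c : Fin (n + 2)) :
    secondFundamentalForm Ψ x i j c = hessian (k := k) (inducedMetric Ψ) (fun z => Ψ z c) x i j +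
      (metricMatrix (inducedMetric Ψ) x (extChartAt (𝓡 k) x x) i j +
        tangentFrame Ψ x i 0 * tangentFrame Ψ x j 0) * unitNormal (Ψ x) c := by
  rw [secondFundamentalForm, covDerivFrame, hΨ.normalPart_tangentProj, hΨ.hessian_apply,
    hΨ.lorentz_partialDeriv_partialDeriv_unitNormal, Pi.sub_apply, Pi.smul_apply, smul_eq_mul]
  ring

theorem IsSpacelikeImmersion.gradNormSq_time (hΨ : IsSpacelikeImmersion k Ψ) (x : M) :
    gradNormSq (k := k) (inducedMetric Ψ) (fun z => Ψ z 0) x =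
      ∑ i : Fin k, ∑ j : Fin k, metricInv (k := k) (inducedMetric Ψ) x i j *
        (tangentFrame Ψ x i 0 * tangentFrame Ψ x j 0) := by
  have hF := hΨ.contDiffAt_inCoord x (mem_extChartAt_target (I := 𝓡 k) x)
  have h1 : ∀ l, partialDeriv l (inCoord x fun z => Ψ z 0) (extChartAt (𝓡 k) x x) =
      tangentFrame Ψ x l 0 := fun l =>
    partialDeriv_clm_comp (ContinuousLinearMap.proj (R := ℝ) (φ := fun _ : Fin (n + 2) => ℝ) 0)
      (hF.differentiableAt two_ne_zero) l
  simp only [gradNormSq, h1]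

/-- The coordinates of the trace of the second fundamental form. -/
theorem IsSpacelikeImmersion.trace_secondFundamentalForm_apply (hΨ : IsSpacelikeImmersion k Ψ)
    (x : M) (c : Fin (n + 2)) :
    (∑ i : Fin k, ∑ j : Fin k,
        metricInv (k := k) (inducedMetric Ψ) x i j • secondFundamentalForm Ψ x i j) c =
      laplacian (k := k) (inducedMetric Ψ) (fun z => Ψ z c) x +
        ((k : ℝ) + gradNormSq (k := k) (inducedMetric Ψ) (fun z => Ψ z 0) x) * unitNormal (Ψ x) c := by
  rw [laplacian, hΨ.gradNormSq_time, ← hΨ.sum_metricInv_mul_metricMatrix x]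
  simp only [Finset.sum_apply, Pi.smul_apply, smul_eq_mul, hΨ.secondFundamentalForm_apply,
    ← Finset.sum_add_distrib, Finset.sum_mul]
  exact Finset.sum_congr rfl fun i _ => Finset.sum_congr rfl fun j _ => by ring

theorem meanCurvature_eq_zero_iff {k : ℕ} {M : Type*} [TopologicalSpace M]
    [ChartedSpace (EuclideanSpace ℝ (Fin k)) M] {n : ℕ} (Ψ : M → Minkowski n) (x : M) :
    meanCurvature k Ψ x = 0 ↔ ∑ i : Fin k, ∑ j : Fin k,
      metricInv (k := k) (inducedMetric Ψ) x i j • secondFundamentalForm Ψ x i j = 0 := by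
  rw [meanCurvature, smul_eq_zero]
  refine ⟨fun h => h.elim (fun hk => ?_) id, Or.inr⟩
  -- The factor `1 / k` vanishes only for k = 0, where `1 / 0 = 0`; the trace is then an empty sum.
  obtain rfl : k = 0 := by simpa using hk
  simp

end Manifold

end SpacelikeImm

end

theorem corollary4 (k n : ℕ) (M : Type*) [TopologicalSpace M]
    [ChartedSpace (EuclideanSpace ℝ (Fin k)) M] [IsManifold (𝓡 k) ∞ M]
    (Ψ : M → SpacelikeImm.Minkowski n) (hΨ : SpacelikeImm.IsSpacelikeImmersion k Ψ) :
    SpacelikeImm.IsStationary k Ψ ↔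
      (∀ x : M, SpacelikeImm.laplacian (k := k) (SpacelikeImm.inducedMetric Ψ)
          (fun z => Ψ z 0) x = 0) ∧
      (∀ (i : Fin (n + 1)) (x : M),
        SpacelikeImm.laplacian (k := k) (SpacelikeImm.inducedMetric Ψ)
            (fun z => Ψ z i.succ) x
          + ((k : ℝ) + SpacelikeImm.gradNormSq (k := k) (SpacelikeImm.inducedMetric Ψ)
              (fun z => Ψ z 0) x) * Ψ x i.succ = 0) := by
  have key : ∀ x : M, SpacelikeImm.meanCurvature k Ψ x = 0 ↔ ∀ c : Fin (n + 2),
      SpacelikeImm.laplacian (k := k) (SpacelikeImm.inducedMetric Ψ) (fun z => Ψ z c) x +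
        ((k : ℝ) + SpacelikeImm.gradNormSq (k := k) (SpacelikeImm.inducedMetric Ψ)
          (fun z => Ψ z 0) x) * SpacelikeImm.unitNormal (Ψ x) c = 0 := by
    intro x
    rw [SpacelikeImm.meanCurvature_eq_zero_iff, funext_iff]
    exact forall_congr' fun c => by rw [hΨ.trace_secondFundamentalForm_apply, Pi.zero_apply]
  -- N has time component 0, which leaves ΔΨ₀ = 0, and spatial components Ψᵢ, which give the other
  -- equations.
  simp only [SpacelikeImm.IsStationary, key, Fin.forall_fin_succ (n := n + 1),
    SpacelikeImm.unitNormal, Fin.cons_zero, Fin.cons_succ, mul_zero, add_zero]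
  exact ⟨fun h => ⟨fun x => (h x).1, fun i x => (h x).2 i⟩, fun h x => ⟨h.1 x, fun i => h.2 i x⟩⟩
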